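/- Let $G=(V,E)$ be a finite connected undirected simple graph with $n=|V|$ nodes, let $d\ge 0$ be an integer, and for each edge $(ij)\in E$ let $K_{ij}>0$ be a step size and $\tau_{ij}\ge 0$ a delay; put $\tau_{\max}=\max_{(ij)\in E}\tau_{ij}$ (with $\tau_{\max}=0$ if $E=\emptyset$). For $x=(x(i))_{i\in V}\in\mathbb{R}^{V\times d}$ let $f_{ij}(x)=\frac12\|x(i)-x(j)\|^2$. For weights $\nu=(\nu_{ij})_{(ij)\in E}$ let $\Delta_G(\nu)\in\mathbb{R}^{V\times V}$ be the weighted Laplacian, with entry $(i,j)$ equal to $-\nu_{ij}$ if $(ij)\in E$, to $\sum_{k\sim i}\nu_{ik}$ if $i=j$, and to $0$ otherwise. Consider the delayed linear ODE $$\frac{\mathrm{d}y_t}{\mathrm{d}t}=-\sum_{(ij)\in E}K_{ij}\,\nabla f_{ij}(y_{t-\tau_{ij}}),\qquad y_t\in\mathbb{R}^{V\times d},$$ whose solutions are the functions $y$ that are continuous on $[-\tau_{\max},\infty)$ and satisfy the equation for all $t>0$ (so that the initial history on $[-\tau_{\max},0]$ is an arbitrary continuous function). If the spectral radius satisfies $\rho\big(\Delta_G(\{\tau_{ij}K_{ij}\})\big)<1$,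 then this delayed ODE is (exponentially) stable: there are constants $C>0$ and $\gamma>0$, not depending on the solution, such that every solution $y$ satisfies, for all $t\ge 0$, $$\|y_t-\mathbf{1}\bar y\|\le C\,e^{-\gamma t}\,\sup_{s\in[-\tau_{\max},0]}\|y_s-\mathbf{1}\bar y\|,$$ where $\bar y=\frac1n\sum_{i\in V}y_0(i)$, where $\mathbf{1}\bar y$ denotes the state in which every node holds $\bar y$, and where $\|\cdot\|$ is the Euclidean norm on $\mathbb{R}^{V\times d}$. In particular, every consensus state is Lyapunov stable and every solution converges to the consensus state of the average of its value at time $0$. -/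

import Mathlib

namespace DelayedGossip

/-- The state space `ℝ^{V × d}`, with the Euclidean inner product. -/
abbrev State (V : Type*) (d : ℕ) : Type _ :=
  EuclideanSpace ℝ (V × Fin d)

/-- The vector `x(i) ∈ ℝ^d` that node `i` holds in the state `x`. -/
def State.node {V : Type*} {d : ℕ} (x : State V d) (i : V) : EuclideanSpace ℝ (Fin d) :=
  WithLp.toLp 2 fun k => x (i, k)

/-- The Laplacian of the graph `G` weighted by `ν` : entry `(i, j)` is `-ν_ij` if `i` and `j` are
adjacent, `∑_{k ∼ i} ν_ik` if `i = j`, and `0` otherwise. -/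
def weightedLaplacian {V : Type*} [Fintype V] [DecidableEq V] (G : SimpleGraph V)
    [DecidableRel G.Adj] (ν : G.edgeSet → ℝ) : Matrix V V ℝ :=
  Matrix.of fun i j =>
    if h : G.Adj i j then -ν ⟨s(i, j), G.mem_edgeSet.mpr h⟩
    else if i = j then ∑ k, if h : G.Adj i k then ν ⟨s(i, k), G.mem_edgeSet.mpr h⟩ else 0
    else 0

/-- The function `f_ij (x) = ‖x(i) - x(j)‖² / 2` of an unordered pair `ij` of nodes. -/
noncomputable def pairEnergy {V : Type*} {d : ℕ} (e : Sym2 V) (x : State V d) : ℝ :=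
  Sym2.lift ⟨fun i j : V => ‖State.node x i - State.node x j‖ ^ 2 / 2,
    fun i j => by simp only [norm_sub_rev]⟩ e

/-- The largest delay `max_{ij ∈ E} τ_ij` (it is `0` if there is no edge). -/
noncomputable def maxDelay {V : Type*} {G : SimpleGraph V} (τ : G.edgeSet → ℝ) : ℝ :=
  ⨆ e, τ e

/-- `y` is a solution, for nonnegative times, of the delayed ODE
`dy/dt = - ∑_{ij ∈ E} K_ij ∇f_ij (y_{t - τ_ij})` with a continuous initial history on
`[-τ_max, 0]`. Values of `y` before `-τ_max` play no role. -/
structure IsSolution {V : Type*} [Fintype V] [DecidableEq V] {G : SimpleGraph V}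
    [DecidableRel G.Adj] {d : ℕ} (K τ : G.edgeSet → ℝ) (y : ℝ → State V d) : Prop where
  continuousOn : ContinuousOn y (Set.Ici (-maxDelay τ))
  hasDerivAt : ∀ t : ℝ, 0 < t →
    HasDerivAt y (-∑ e : G.edgeSet, K e • gradient (pairEnergy (e : Sym2 V)) (y (t - τ e))) t

/-- The consensus state, in which every node holds the average `(1/n) ∑ j, x(j)`. -/
noncomputable def consensus {V : Type*} [Fintype V] {d : ℕ} (x : State V d) : State V d :=
  WithLp.toLp 2 fun p => (Fintype.card V : ℝ)⁻¹ * ∑ j, x (j, p.2)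

/-- Stability of the delayed ODE on `ℝ^{V × d}`, in the strong (uniform exponential) sense. The
right-hand side depends only on differences between nodes and preserves the average, so every
consensus state is an equilibrium and the consensus state of `y 0` is the only possible limit of a
solution `y`. Every solution converges to it exponentially fast, with a rate and a constant that do
not depend on the solution, relative to the largest deviation of the initial history. In
particular the consensus states are Lyapunov stable and all solutions converge to consensus. -/
def IsStable {V : Type*} [Fintype V] [DecidableEq V] {G : SimpleGraph V}
    [DecidableRel G.Adj] (d : ℕ) (K τ : G.edgeSet → ℝ) : Prop :=
  ∃ C γ : ℝ, 0 < C ∧ 0 < γ ∧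
    ∀ y : ℝ → State V d, IsSolution K τ y →
      ∀ R : ℝ, (∀ s ∈ Set.Icc (-maxDelay τ) 0, ‖y s - consensus (y 0)‖ ≤ R) →
        ∀ t : ℝ, 0 ≤ t → ‖y t - consensus (y 0)‖ ≤ C * R * Real.exp (-γ * t)

end DelayedGossip

/-! The equation is a delayed gradient flow `x' = -∑ e, K e • (D e)† (D e (x (t - τ e)))`, where
`D e` is the difference across the edge `e`. The heuristic is in the frequency domain: testing a
mode `e^{st} u`, `s = a + iω`, `a ≥ 0`, `‖u‖ = 1`, against itself and taking imaginary parts gives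
`ω = ∑ e, K e e^{-a τ e} sin (ω τ e) ‖D e u‖²`, of absolute value at most
`|ω| ∑ e, K e τ e ‖D e u‖²`. The last sum is the quadratic form of the Laplacian with weights
`τ e * K e`, hence is at most some `ρ < 1`, so `ω = 0`, and then `u` is a consensus state and
`s = 0`.

The proof is the time-domain form of this argument, where the imaginary part becomes the pairing of
the equation with the velocity `x'`. Write `D e (x (t - τ e))` as `D e (x t)` minus its increment
over `[t - τ e, t]`. The increments are absorbed, by Young's inequality
(`inner_sub_le_of_primitive`), into the Krasovskii terms of the functional
`½ ∑ e, K e (‖D e x‖² + ∫_{t-τ e}^t (s - t + τ e) ‖D e x'(s)‖² ds)`, whose derivative is thus at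
most `-‖x'‖² + ∑ e, τ e K e ‖D e x'‖² ≤ -(1 - ρ) ‖x'‖²`. A small further Krasovskii term for
`‖x'‖²` makes the dissipation also control the recent history of `x'`; since the energy is coercive
(the graph is connected and the deviation has zero average), the dissipation then dominates a
multiple of the functional, which therefore decays exponentially (`exists_lyapunov`). This works
once all the delayed times are positive. Before that, solutions grow at most exponentially
(`norm_le_of_delayed`). -/

namespace DelayedGossip

/-! ### Primitives and Krasovskii terms -/

section Krasovskii

/-- An integrated form of Young's inequality `⟪c, z'⟫ ≤ (‖c‖² + ‖z'‖²) / 2`. Here `P` is a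
primitive of the squared speed of the curve `z`. -/
lemma inner_sub_le_of_primitive {F : Type*} [NormedAddCommGroup F] [InnerProductSpace ℝ F]
    {z z' : ℝ → F} {P : ℝ → ℝ} {a b : ℝ} (hab : a ≤ b)
    (hz : ∀ s ∈ Set.Icc a b, HasDerivAt z (z' s) s)
    (hP : ∀ s, HasDerivAt P (‖z' s‖ ^ 2) s) (c : F) :
    inner ℝ c (z b - z a) ≤ ((b - a) * ‖c‖ ^ 2 + (P b - P a)) / 2 := by
  have hd : ∀ s ∈ Set.Icc a b, HasDerivAt (fun s => (s * ‖c‖ ^ 2 + P s) / 2 - inner ℝ c (z s))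
      ((1 * ‖c‖ ^ 2 + ‖z' s‖ ^ 2) / 2 - inner ℝ c (z' s)) s := by
    intro s hs
    have h1 := (((hasDerivAt_id s).mul_const (‖c‖ ^ 2)).add (hP s)).div_const 2
    have h2 := ((innerSL ℝ c).hasFDerivAt (x := z s)).comp_hasDerivAt s (hz s hs)
    exact h1.sub h2
  have hm : MonotoneOn (fun s => (s * ‖c‖ ^ 2 + P s) / 2 - inner ℝ c (z s)) (Set.Icc a b) := by
    refine monotoneOn_of_hasDerivWithinAt_nonneg (convex_Icc a b)
      (fun s hs => (hd s hs).continuousAt.continuousWithinAt)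
      (fun s hs => (hd s (interior_subset hs)).hasDerivWithinAt) (fun s _ => ?_)
    have h := norm_sub_sq_real c (z' s)
    nlinarith [sq_nonneg ‖c - z' s‖]
  have h := hm (Set.left_mem_Icc.2 hab) (Set.right_mem_Icc.2 hab) hab
  simp only [inner_sub_right] at h ⊢
  linarith

/-- Displacement over a time span is controlled by the integral of the squared speed.
The factor `b - a + 1` avoids a case distinction at `a = b`. -/
lemma norm_sub_sq_le_of_primitive {F : Type*} [NormedAddCommGroup F] [InnerProductSpace ℝ F]
    {z z' : ℝ → F} {P : ℝ → ℝ} {a b : ℝ} (hab : a ≤ b)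
    (hz : ∀ s ∈ Set.Icc a b, HasDerivAt z (z' s) s)
    (hP : ∀ s, HasDerivAt P (‖z' s‖ ^ 2) s) :
    ‖z b - z a‖ ^ 2 ≤ (b - a + 1) * (P b - P a) := by
  have hpos : 0 < b - a + 1 := by linarith
  have h := inner_sub_le_of_primitive hab hz hP ((b - a + 1)⁻¹ • (z b - z a))
  rw [real_inner_smul_left, real_inner_self_eq_norm_sq, norm_smul, mul_pow, Real.norm_eq_abs,
    sq_abs] at h
  have h' := mul_le_mul_of_nonneg_left h (mul_pos hpos hpos).le
  have e1 : (b - a + 1) * (b - a + 1) * ((b - a + 1)⁻¹ * ‖z b - z a‖ ^ 2)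
      = (b - a + 1) * ‖z b - z a‖ ^ 2 := by field_simp
  have e2 : (b - a + 1) * (b - a + 1) *
      (((b - a) * ((b - a + 1)⁻¹ ^ 2 * ‖z b - z a‖ ^ 2) + (P b - P a)) / 2)
      = ((b - a) * ‖z b - z a‖ ^ 2 + (b - a + 1) * ((b - a + 1) * (P b - P a))) / 2 := by
    field_simp
  rw [e1, e2] at h'
  have hsq := sq_nonneg ‖z b - z a‖
  have h3 : (b - a + 2) * ‖z b - z a‖ ^ 2 ≤ (b - a + 1) * ((b - a + 1) * (P b - P a)) := by
    linarith
  have h4 : (b - a + 1) * ‖z b - z a‖ ^ 2 ≤ (b - a + 1) * ((b - a + 1) * (P b - P a)) := by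
    linarith
  exact le_of_mul_le_mul_left h4 hpos

/-- If `P` is a primitive of `w` and `S` a primitive of `P`, this is
`∫_{t-r}^t (s - t + r) w(s) ds`, the Krasovskii term of delay `r`. -/
def krasovskii (P S : ℝ → ℝ) (r t : ℝ) : ℝ :=
  r * P t - (S t - S (t - r))

lemma hasDerivAt_krasovskii {P S w : ℝ → ℝ} (hP : ∀ s, HasDerivAt P (w s) s)
    (hS : ∀ s, HasDerivAt S (P s) s) (r t : ℝ) :
    HasDerivAt (krasovskii P S r) (r * w t - (P t - P (t - r))) t :=
  ((hP t).const_mul r).sub ((hS t).sub ((hS (t - r)).comp_sub_const t r))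

lemma krasovskii_nonneg {P S : ℝ → ℝ} (hP : Monotone P)
    (hS : ∀ s, HasDerivAt S (P s) s) {r : ℝ} (hr : 0 ≤ r) (t : ℝ) :
    0 ≤ krasovskii P S r t := by
  have h := (convex_Icc (t - r) t).image_sub_le_mul_sub_of_deriv_le
    (f := S) (C := P t) (fun s _ => (hS s).continuousAt.continuousWithinAt)
    (fun s _ => (hS s).differentiableAt.differentiableWithinAt)
    (fun s hs => by rw [(hS s).deriv]; exact hP (interior_subset hs).2)
    (t - r) ⟨le_rfl, by linarith⟩ t ⟨by linarith, le_rfl⟩ (by linarith)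
  unfold krasovskii
  linarith

lemma krasovskii_le {P S : ℝ → ℝ} (hP : Monotone P)
    (hS : ∀ s, HasDerivAt S (P s) s) {r : ℝ} (hr : 0 ≤ r) (t : ℝ) :
    krasovskii P S r t ≤ r * (P t - P (t - r)) := by
  have h := (convex_Icc (t - r) t).mul_sub_le_image_sub_of_le_deriv
    (f := S) (C := P (t - r)) (fun s _ => (hS s).continuousAt.continuousWithinAt)
    (fun s _ => (hS s).differentiableAt.differentiableWithinAt)
    (fun s hs => by rw [(hS s).deriv]; exact hP (interior_subset hs).1)
    (t - r) ⟨le_rfl, by linarith⟩ t ⟨by linarith, le_rfl⟩ (by linarith)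
  unfold krasovskii
  linarith

lemma exists_primitive {w : ℝ → ℝ} (hw : Continuous w) :
    ∃ P : ℝ → ℝ, ∀ s, HasDerivAt P (w s) s :=
  ⟨fun t => ∫ s in (0 : ℝ)..t, w s, fun s => hw.integral_hasStrictDerivAt 0 s |>.hasDerivAt⟩

lemma sub_le_sub_of_deriv_le {P Q p q : ℝ → ℝ} (hP : ∀ s, HasDerivAt P (p s) s)
    (hQ : ∀ s, HasDerivAt Q (q s) s) {a b : ℝ} (hab : a ≤ b)
    (h : ∀ s ∈ Set.Icc a b, p s ≤ q s) : P b - P a ≤ Q b - Q a := by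
  have hm : MonotoneOn (fun s => Q s - P s) (Set.Icc a b) :=
    monotoneOn_of_hasDerivWithinAt_nonneg (convex_Icc a b)
      (fun s _ => ((hQ s).sub (hP s)).continuousAt.continuousWithinAt)
      (fun s _ => ((hQ s).sub (hP s)).hasDerivWithinAt)
      (fun s hs => sub_nonneg.2 (h s (interior_subset hs)))
  have := hm (Set.left_mem_Icc.2 hab) (Set.right_mem_Icc.2 hab) hab
  simp only at this
  linarith

end Krasovskii

/-! ### Delayed gradient flows of quadratic energies -/

section Delay

variable {ι E F : Type*} [Fintype ι] [NormedAddCommGroup E] [InnerProductSpace ℝ E]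
  [CompleteSpace E] [NormedAddCommGroup F] [InnerProductSpace ℝ F] [CompleteSpace F]

/-- The right-hand side `-∑ e, K e • (D e)† (D e (x (t - τ e)))` of the delayed gradient flow of
the quadratic energy `x ↦ ∑ e, K e * ‖D e x‖² / 2`. -/
noncomputable def delayedVelocity (D : ι → E →L[ℝ] F) (K τ : ι → ℝ) (x : ℝ → E) (t : ℝ) : E :=
  -∑ e, K e • (D e).adjoint (D e (x (t - τ e)))

variable {D : ι → E →L[ℝ] F} {K τ : ι → ℝ} {x : ℝ → E}

lemma continuous_delayedVelocity (hx : Continuous x) : Continuous (delayedVelocity D K τ x) := by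
  unfold delayedVelocity
  fun_prop

lemma inner_delayedVelocity (u : E) (t : ℝ) :
    inner ℝ u (delayedVelocity D K τ x t)
      = -∑ e, K e * inner ℝ (D e u) (D e (x (t - τ e))) := by
  simp [delayedVelocity, inner_neg_right, inner_sum, real_inner_smul_right,
    ContinuousLinearMap.adjoint_inner_right]

lemma norm_delayedVelocity_le (hK : ∀ e, 0 ≤ K e) {B t : ℝ} (hB : ∀ e, ‖x (t - τ e)‖ ≤ B) :
    ‖delayedVelocity D K τ x t‖ ≤ (∑ e, K e * ‖D e‖ ^ 2) * B := by
  rw [delayedVelocity, norm_neg, Finset.sum_mul]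
  refine (norm_sum_le _ _).trans (Finset.sum_le_sum fun e _ => ?_)
  rw [norm_smul, Real.norm_eq_abs, abs_of_nonneg (hK e), mul_assoc]
  refine mul_le_mul_of_nonneg_left ?_ (hK e)
  calc ‖(D e).adjoint (D e (x (t - τ e)))‖ ≤ ‖(D e).adjoint‖ * (‖D e‖ * ‖x (t - τ e)‖) :=
        (ContinuousLinearMap.le_opNorm _ _).trans
          (mul_le_mul_of_nonneg_left (ContinuousLinearMap.le_opNorm _ _) (norm_nonneg _))
    _ ≤ ‖D e‖ * (‖D e‖ * B) := by
        rw [LinearIsometryEquiv.norm_map]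
        gcongr
        exact hB e
    _ = _ := by ring

/-- A priori growth bound, from the maximum of `‖x s‖ e^{-2M max(s, 0)}`: over a time
span `[0, t]` the equation reproduces at most half of that maximum. -/
lemma norm_le_of_delayed (hK : ∀ e, 0 ≤ K e) (hτ : ∀ e, 0 ≤ τ e) {r : ℝ} (hr : 0 ≤ r)
    (hτr : ∀ e, τ e ≤ r) (hx : Continuous x)
    (hd : ∀ t, 0 < t → HasDerivAt x (delayedVelocity D K τ x t) t) {M R : ℝ}
    (hM : 0 < M) (hDM : ∑ e, K e * ‖D e‖ ^ 2 ≤ M)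
    (hR : ∀ s ∈ Set.Icc (-r) 0, ‖x s‖ ≤ R) {T : ℝ} (hT : 0 ≤ T) :
    ∀ s ∈ Set.Icc (-r) T, ‖x s‖ ≤ 2 * R * Real.exp (2 * M * T) := by
  have hR0 : 0 ≤ R := (norm_nonneg _).trans (hR 0 ⟨by linarith, le_rfl⟩)
  have hcont : Continuous fun s => ‖x s‖ * Real.exp (-(2 * M * max s 0)) := by fun_prop
  obtain ⟨m, hm, hmax⟩ := (isCompact_Icc (a := -r) (b := T)).exists_isMaxOn
    ⟨0, by linarith, hT⟩ hcont.continuousOn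
  set S := ‖x m‖ * Real.exp (-(2 * M * max m 0)) with hS
  have hS0 : 0 ≤ S := by positivity
  have hbound : ∀ s ∈ Set.Icc (-r) T, ‖x s‖ ≤ S * Real.exp (2 * M * max s 0) := by
    intro s hs
    have h : ‖x s‖ * Real.exp (-(2 * M * max s 0)) ≤ S := hmax hs
    calc ‖x s‖ = ‖x s‖ * Real.exp (-(2 * M * max s 0)) * Real.exp (2 * M * max s 0) := by
          rw [mul_assoc, ← Real.exp_add]; simp
      _ ≤ _ := by gcongr
  have hSR : S ≤ 2 * R := by
    rcases le_or_gt m 0 with hm0 | hm0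
    · have : S ≤ R := by
        rw [hS, max_eq_right hm0]
        simpa using hR m ⟨hm.1, hm0⟩
      linarith
    · have hB : ∀ t, HasDerivAt (fun t => S / 2 * (Real.exp (2 * M * t) - 1))
          (M * (S * Real.exp (2 * M * t))) t := by
        intro t
        refine ((((hasDerivAt_id t).const_mul (2 * M)).exp.sub_const 1).const_mul
          (S / 2)).congr_deriv ?_
        simp only [id, mul_one]
        ring
      have hder : ∀ t ∈ Set.Ioo 0 m, ‖delayedVelocity D K τ x t‖
          ≤ M * (S * Real.exp (2 * M * t)) := by
        intro t ht
        refine (norm_delayedVelocity_le (B := S * Real.exp (2 * M * t)) hK fun e => ?_).trans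
          (mul_le_mul_of_nonneg_right hDM (by positivity))
        refine (hbound _ ⟨by linarith [hτr e, ht.1], by linarith [hτ e, ht.2, hm.2]⟩).trans ?_
        gcongr
        exact max_le (by linarith [hτ e]) ht.1.le
      have hle : ‖x m‖ ≤ R + S / 2 * (Real.exp (2 * M * m) - 1) := by
        -- The equation may fail at time `0`, so start at small positive times.
        have hpos : ∀ a ∈ Set.Ioo 0 m, ‖x m‖ ≤ ‖x a‖ +
            (S / 2 * (Real.exp (2 * M * m) - 1) - S / 2 * (Real.exp (2 * M * a) - 1)) := by
          intro a ha
          refine image_norm_le_of_norm_deriv_right_le_deriv_boundary (f := x)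
            (B := fun t => ‖x a‖ +
            (S / 2 * (Real.exp (2 * M * t) - 1) - S / 2 * (Real.exp (2 * M * a) - 1)))
            (f' := delayedVelocity D K τ x)
            (B' := fun t => M * (S * Real.exp (2 * M * t))) hx.continuousOn
            (fun t ht => (hd t (ha.1.trans_le ht.1)).hasDerivWithinAt) (by simp)
            (fun t => ((hB t).sub_const _).const_add _)
            (fun t ht => hder t ⟨ha.1.trans_le ht.1, ht.2⟩)
            ⟨ha.2.le, le_rfl⟩
        have hlim : Filter.Tendsto (fun a => ‖x a‖ +
            (S / 2 * (Real.exp (2 * M * m) - 1) - S / 2 * (Real.exp (2 * M * a) - 1)))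
            (nhdsWithin 0 (Set.Ioi 0)) (nhds (‖x 0‖ +
            (S / 2 * (Real.exp (2 * M * m) - 1) - S / 2 * (Real.exp (2 * M * 0) - 1)))) := by
          refine (Continuous.tendsto ?_ 0).mono_left nhdsWithin_le_nhds
          fun_prop
        have h := ge_of_tendsto hlim
          (Filter.mem_of_superset (Ioo_mem_nhdsGT hm0) hpos)
        have h0 := hR 0 ⟨by linarith, le_rfl⟩
        simp only [mul_zero, Real.exp_zero, sub_self, sub_zero] at h
        linarith
      have hxm : ‖x m‖ = S * Real.exp (2 * M * m) := by
        rw [hS, max_eq_left hm0.le, mul_assoc, ← Real.exp_add]; simp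
      have h1 : 1 ≤ Real.exp (2 * M * m) := Real.one_le_exp (by positivity)
      rw [hxm] at hle
      have h2 : S * Real.exp (2 * M * m) ≤ 2 * R - S := by linarith
      nlinarith
  intro s hs
  refine (hbound s hs).trans ?_
  gcongr
  exact max_le hs.2 hT

/-- Decay of the Lyapunov-Krasovskii functional. The integrals of the functional enter through
primitives `P e` of `‖D e x'‖²` and `P₀` of `‖x'‖²`. -/
lemma exists_lyapunov (hK : ∀ e, 0 ≤ K e) (hτ : ∀ e, 0 ≤ τ e) {r : ℝ} (hr : 0 ≤ r)
    (hτr : ∀ e, τ e ≤ r) {ρ lam : ℝ} (hρ : ρ < 1) (hlam : 0 < lam)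
    (hform : ∀ u : E, ∑ e, τ e * K e * ‖D e u‖ ^ 2 ≤ ρ * ‖u‖ ^ 2) :
    ∃ C γ : ℝ, 0 < C ∧ 0 < γ ∧ ∀ (x : ℝ → E) (_ : Continuous x)
      (_ : ∀ t, 0 < t → HasDerivAt x (delayedVelocity D K τ x t) t)
      (_ : ∀ t, 0 < t → lam * ‖x t‖ ^ 2 ≤ ∑ e, K e * ‖D e (x t)‖ ^ 2) (A : ℝ),
      (∀ s ∈ Set.Icc 1 (r + 1), ‖delayedVelocity D K τ x s‖ ^ 2 ≤ A) →
      ∀ t, r + 1 ≤ t → ‖x t‖ ^ 2 ≤ C * A * Real.exp (-γ * (t - (r + 1))) := by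
  -- Small enough that the extra Krasovskii term costs at most half of the gain `1 - ρ`.
  set η := (1 - ρ) / (2 * (r + 1)) with hη
  have hη0 : 0 < η := by have : 0 < 1 - ρ := by linarith
                         positivity
  have hηr : η * r + η = (1 - ρ) / 2 := by rw [hη]; field_simp
  set C₁ := 1 / lam + ∑ e, K e * ((r + 1) * ‖D e‖ ^ 2) + ∑ e, K e * (r * ‖D e‖ ^ 2) + η * r
    with hC₁
  have hsum1 : 0 ≤ ∑ e, K e * ((r + 1) * ‖D e‖ ^ 2) :=
    Finset.sum_nonneg fun e _ => mul_nonneg (hK e) (by positivity)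
  have hsum2 : 0 ≤ ∑ e, K e * (r * ‖D e‖ ^ 2) :=
    Finset.sum_nonneg fun e _ => mul_nonneg (hK e) (by positivity)
  have hC₁0 : 0 < C₁ := by positivity
  refine ⟨2 / lam * (C₁ * (1 + r)), η / C₁, by positivity, by positivity, ?_⟩
  intro x hx hd hco A hA t ht
  set v := delayedVelocity D K τ x with hv
  have hvc : Continuous v := continuous_delayedVelocity hx
  choose P hP using fun e => exists_primitive (w := fun s => ‖D e (v s)‖ ^ 2) (by fun_prop)
  obtain ⟨P₀, hP₀⟩ := exists_primitive (w := fun s => ‖v s‖ ^ 2) (by fun_prop)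
  have hmono : ∀ {Q q : ℝ → ℝ}, (∀ s, HasDerivAt Q (q s) s) → (∀ s, 0 ≤ q s) → Monotone Q :=
    fun hQ hq => monotone_of_hasDerivAt_nonneg hQ hq
  have hPm : ∀ e, Monotone (P e) := fun e => hmono (hP e) fun s => sq_nonneg _
  have hP₀m : Monotone P₀ := hmono hP₀ fun s => sq_nonneg _
  choose S hS using fun e => exists_primitive (w := P e)
    (continuous_iff_continuousAt.2 fun s => (hP e s).continuousAt)
  obtain ⟨S₀, hS₀⟩ := exists_primitive (w := P₀)
    (continuous_iff_continuousAt.2 fun s => (hP₀ s).continuousAt)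
  set Ψ : ℝ → ℝ := fun t => ∑ e, K e * (‖D e (x t)‖ ^ 2 / 2 + krasovskii (P e) (S e) (τ e) t / 2)
    + η * krasovskii P₀ S₀ r t with hΨ
  -- `Ψ' ≤ -η W` and `Ψ ≤ C₁ W` together give exponential decay of `Ψ`.
  set W : ℝ → ℝ := fun t => ‖v t‖ ^ 2 + (P₀ t - P₀ (t - r)) with hW
  have hPP₀ : ∀ e t, P e t - P e (t - τ e) ≤ ‖D e‖ ^ 2 * (P₀ t - P₀ (t - r)) := by
    intro e t
    have h := sub_le_sub_of_deriv_le (hP e) (fun s => (hP₀ s).const_mul (‖D e‖ ^ 2))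
      (show t - τ e ≤ t by linarith [hτ e]) (fun s _ => by
        rw [← mul_pow]
        exact pow_le_pow_left₀ (norm_nonneg _) ((D e).le_opNorm _) 2)
    have h2 : P₀ (t - r) ≤ P₀ (t - τ e) := hP₀m (by linarith [hτr e])
    nlinarith [sq_nonneg ‖D e‖]
  have hDx : ∀ e t, 0 < t → HasDerivAt (fun s => D e (x s)) (D e (v t)) t := fun e t ht =>
    (D e).hasFDerivAt.comp_hasDerivAt t (hd t ht)
  have hseg : ∀ e t, r < t → ∀ s ∈ Set.Icc (t - τ e) t,
      HasDerivAt (fun s => D e (x s)) (D e (v s)) s := fun e t ht s hs =>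
    hDx e s (by linarith [hs.1, hτr e])
  have hΨder : ∀ t, r < t → HasDerivAt Ψ
      (∑ e, K e * (inner ℝ (D e (v t)) (D e (x t))
        + (τ e * ‖D e (v t)‖ ^ 2 - (P e t - P e (t - τ e))) / 2)
        + η * (r * ‖v t‖ ^ 2 - (P₀ t - P₀ (t - r)))) t := by
    intro t ht
    refine HasDerivAt.add (HasDerivAt.fun_sum fun e _ =>
      HasDerivAt.const_mul _ (HasDerivAt.add ?_ ?_))
      ((hasDerivAt_krasovskii hP₀ hS₀ r t).const_mul η)
    · refine ((hDx e t (hr.trans_lt ht)).norm_sq.div_const 2).congr_deriv ?_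
      rw [real_inner_comm]
      ring
    · exact (hasDerivAt_krasovskii (hP e) (hS e) (τ e) t).div_const 2
  have hΨle : ∀ t, r < t → Ψ t ≤ C₁ * W t := by
    intro t ht
    have hP₀0 : 0 ≤ P₀ t - P₀ (t - r) := sub_nonneg.2 (hP₀m (by linarith))
    have hv0 := sq_nonneg ‖v t‖
    set q := ∑ e, K e * ‖D e (x t)‖ ^ 2 with hq
    have hid : q = -inner ℝ (x t) (v t)
        + ∑ e, K e * inner ℝ (D e (x t)) (D e (x t) - D e (x (t - τ e))) := by
      rw [hv, inner_delayedVelocity, neg_neg, ← Finset.sum_add_distrib, hq]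
      refine Finset.sum_congr rfl fun e _ => ?_
      rw [inner_sub_right, real_inner_self_eq_norm_sq]
      ring
    have h1 : -inner ℝ (x t) (v t) ≤ q / 4 + ‖v t‖ ^ 2 / lam := by
      have h := abs_real_inner_le_norm (x t) (v t)
      have h' := neg_le_abs (inner ℝ (x t) (v t))
      have hc := hco t (hr.trans_lt ht)
      have hy : ‖x t‖ * ‖v t‖ ≤ lam * ‖x t‖ ^ 2 / 4 + ‖v t‖ ^ 2 / lam := by
        have : lam * ‖x t‖ ^ 2 / 4 + ‖v t‖ ^ 2 / lam - ‖x t‖ * ‖v t‖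
            = (lam * ‖x t‖ / 2 - ‖v t‖) ^ 2 / lam := by field_simp; ring
        have h2 : 0 ≤ (lam * ‖x t‖ / 2 - ‖v t‖) ^ 2 / lam := by positivity
        linarith
      linarith
    have h2 : ∑ e, K e * inner ℝ (D e (x t)) (D e (x t) - D e (x (t - τ e)))
        ≤ q / 4 + (∑ e, K e * ((r + 1) * ‖D e‖ ^ 2)) * (P₀ t - P₀ (t - r)) := by
      rw [hq, Finset.sum_div, Finset.sum_mul, ← Finset.sum_add_distrib]
      refine Finset.sum_le_sum fun e _ => ?_
      have hΔ := norm_sub_sq_le_of_primitive (show t - τ e ≤ t by linarith [hτ e])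
        (hseg e t ht) (hP e)
      have ha : t - (t - τ e) + 1 ≤ r + 1 := by linarith [hτr e]
      have hPe : 0 ≤ P e t - P e (t - τ e) := sub_nonneg.2 (hPm e (by linarith [hτ e]))
      have hΔ' : ‖D e (x t) - D e (x (t - τ e))‖ ^ 2
          ≤ (r + 1) * (‖D e‖ ^ 2 * (P₀ t - P₀ (t - r))) :=
        hΔ.trans ((mul_le_mul_of_nonneg_right ha hPe).trans
          (mul_le_mul_of_nonneg_left (hPP₀ e t) (by linarith)))
      have hi := real_inner_le_norm (D e (x t)) (D e (x t) - D e (x (t - τ e)))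
      have : inner ℝ (D e (x t)) (D e (x t) - D e (x (t - τ e))) ≤ ‖D e (x t)‖ ^ 2 / 4
          + (r + 1) * (‖D e‖ ^ 2 * (P₀ t - P₀ (t - r))) := by
        nlinarith [sq_nonneg (‖D e (x t)‖ / 2 - ‖D e (x t) - D e (x (t - τ e))‖)]
      have := mul_le_mul_of_nonneg_left this (hK e)
      linarith
    have h3 : ∑ e, K e * (‖D e (x t)‖ ^ 2 / 2 + krasovskii (P e) (S e) (τ e) t / 2)
        ≤ q / 2 + (∑ e, K e * (r * ‖D e‖ ^ 2)) * (P₀ t - P₀ (t - r)) := by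
      rw [hq, Finset.sum_div, Finset.sum_mul, ← Finset.sum_add_distrib]
      refine Finset.sum_le_sum fun e _ => ?_
      have hk := krasovskii_le (hPm e) (hS e) (hτ e) t
      have hk0 := krasovskii_nonneg (hPm e) (hS e) (hτ e) t
      have hPe : 0 ≤ P e t - P e (t - τ e) := sub_nonneg.2 (hPm e (by linarith [hτ e]))
      have hk' : krasovskii (P e) (S e) (τ e) t ≤ r * (‖D e‖ ^ 2 * (P₀ t - P₀ (t - r))) :=
        hk.trans ((mul_le_mul_of_nonneg_right (hτr e) hPe).trans
          (mul_le_mul_of_nonneg_left (hPP₀ e t) hr))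
      have : ‖D e (x t)‖ ^ 2 / 2 + krasovskii (P e) (S e) (τ e) t / 2
          ≤ ‖D e (x t)‖ ^ 2 / 2 + r * (‖D e‖ ^ 2 * (P₀ t - P₀ (t - r))) := by linarith
      have := mul_le_mul_of_nonneg_left this (hK e)
      linarith
    have h4 := mul_le_mul_of_nonneg_left (krasovskii_le hP₀m hS₀ hr t) hη0.le
    have h5 : 0 ≤ (1 / lam) * (P₀ t - P₀ (t - r)) := by positivity
    have h6 : 0 ≤ (∑ e, K e * ((r + 1) * ‖D e‖ ^ 2) + ∑ e, K e * (r * ‖D e‖ ^ 2) + η * r)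
      * ‖v t‖ ^ 2 := by positivity
    have h7 : ‖v t‖ ^ 2 / lam = 1 / lam * ‖v t‖ ^ 2 := by ring
    simp only [hΨ, hW, hC₁]
    linarith
  have hdecay : ∀ t, r < t → ∑ e, K e * (inner ℝ (D e (v t)) (D e (x t))
        + (τ e * ‖D e (v t)‖ ^ 2 - (P e t - P e (t - τ e))) / 2)
        + η * (r * ‖v t‖ ^ 2 - (P₀ t - P₀ (t - r))) ≤ -η * W t := by
    intro t ht
    have h1 : ‖v t‖ ^ 2 = -∑ e, K e * inner ℝ (D e (v t)) (D e (x (t - τ e))) := by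
      rw [← real_inner_self_eq_norm_sq]
      exact inner_delayedVelocity (v t) t
    have h2 : ∑ e, K e * (inner ℝ (D e (v t)) (D e (x t))
          + (τ e * ‖D e (v t)‖ ^ 2 - (P e t - P e (t - τ e))) / 2)
        ≤ ∑ e, K e * inner ℝ (D e (v t)) (D e (x (t - τ e)))
          + ∑ e, τ e * K e * ‖D e (v t)‖ ^ 2 := by
      rw [← Finset.sum_add_distrib]
      refine Finset.sum_le_sum fun e _ => ?_
      have h := inner_sub_le_of_primitive (show t - τ e ≤ t by linarith [hτ e])
        (hseg e t ht) (hP e) (D e (v t))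
      rw [inner_sub_right] at h
      have : inner ℝ (D e (v t)) (D e (x t))
          + (τ e * ‖D e (v t)‖ ^ 2 - (P e t - P e (t - τ e))) / 2
          ≤ inner ℝ (D e (v t)) (D e (x (t - τ e))) + τ e * ‖D e (v t)‖ ^ 2 := by linarith
      have := mul_le_mul_of_nonneg_left this (hK e)
      linarith
    have h3 := hform (v t)
    have hv0 := sq_nonneg ‖v t‖
    have h4 : 0 ≤ (1 - ρ - (η * r + η)) * ‖v t‖ ^ 2 := by
      rw [hηr]
      exact mul_nonneg (by linarith) hv0
    simp only [hW]
    linarith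
  have hanti : AntitoneOn (fun t => Ψ t * Real.exp (η / C₁ * t)) (Set.Ici (r + 1)) := by
    have hder : ∀ t, r < t → HasDerivAt (fun t => Ψ t * Real.exp (η / C₁ * t)) _ t :=
      fun t ht => (hΨder t ht).mul ((hasDerivAt_id t).const_mul (η / C₁)).exp
    have hmem : ∀ t ∈ Set.Ici (r + 1), r < t := fun t ht => by
      have : r + 1 ≤ t := ht
      linarith
    refine antitoneOn_of_hasDerivWithinAt_nonpos (convex_Ici _)
      (fun t ht => (hder t (hmem t ht)).continuousAt.continuousWithinAt)
      (fun t ht => (hder t (hmem t (interior_subset ht))).hasDerivWithinAt) (fun t ht => ?_)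
    have htr := hmem t (interior_subset ht)
    have h1 := hdecay t htr
    have h2 : η / C₁ * Ψ t ≤ η * W t :=
      calc η / C₁ * Ψ t ≤ η / C₁ * (C₁ * W t) := by gcongr; exact hΨle t htr
        _ = _ := by field_simp
    simp only [id, mul_one]
    have h3 := (Real.exp_pos (η / C₁ * t)).le
    have h4 := mul_le_mul_of_nonneg_right (add_le_add h1 h2) h3
    linarith
  have hlow : lam / 2 * ‖x t‖ ^ 2 ≤ Ψ t := by
    have h1 := hco t (by linarith)
    have h2 : ∑ e, K e * ‖D e (x t)‖ ^ 2 / 2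
        ≤ ∑ e, K e * (‖D e (x t)‖ ^ 2 / 2 + krasovskii (P e) (S e) (τ e) t / 2) := by
      refine Finset.sum_le_sum fun e _ => ?_
      have := mul_nonneg (hK e) (krasovskii_nonneg (hPm e) (hS e) (hτ e) t)
      linarith
    have h3 := mul_nonneg hη0.le (krasovskii_nonneg hP₀m hS₀ hr t)
    rw [← Finset.sum_div] at h2
    simp only [hΨ]
    linarith
  have hstart : Ψ (r + 1) ≤ C₁ * ((1 + r) * A) := by
    refine (hΨle (r + 1) (by linarith)).trans (mul_le_mul_of_nonneg_left ?_ hC₁0.le)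
    have h := sub_le_sub_of_deriv_le hP₀ (fun s => (hasDerivAt_id s).const_mul A)
      (show r + 1 - r ≤ r + 1 by linarith) (fun s hs => by
        rw [mul_one]; exact hA s ⟨by linarith [hs.1], hs.2⟩)
    have h' := hA (r + 1) ⟨by linarith, le_rfl⟩
    simp only [id] at h
    simp only [hW]
    linarith
  have hfin := hanti (Set.self_mem_Ici) (show t ∈ Set.Ici (r + 1) from ht) ht
  simp only at hfin
  have hexp : Real.exp (-(η / C₁) * (t - (r + 1)))
      = Real.exp (η / C₁ * (r + 1)) * (Real.exp (η / C₁ * t))⁻¹ := by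
    rw [← Real.exp_neg, ← Real.exp_add]
    ring_nf
  have hΨt : Ψ t ≤ C₁ * ((1 + r) * A) * Real.exp (-(η / C₁) * (t - (r + 1))) := by
    rw [hexp, ← mul_assoc, ← div_eq_mul_inv, le_div_iff₀ (Real.exp_pos _)]
    exact hfin.trans (mul_le_mul_of_nonneg_right hstart (Real.exp_pos _).le)
  have h := mul_le_mul_of_nonneg_left (hlow.trans hΨt) (show 0 ≤ 2 / lam by positivity)
  calc ‖x t‖ ^ 2 = 2 / lam * (lam / 2 * ‖x t‖ ^ 2) := by field_simp
    _ ≤ _ := h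
    _ = _ := by ring

/-- Uniform exponential stability of a delayed quadratic gradient flow, on trajectories along
which the energy is coercive. -/
theorem exists_exponential_bound (hK : ∀ e, 0 ≤ K e) (hτ : ∀ e, 0 ≤ τ e) {r : ℝ} (hr : 0 ≤ r)
    (hτr : ∀ e, τ e ≤ r) {ρ lam : ℝ} (hρ : ρ < 1) (hlam : 0 < lam)
    (hform : ∀ u : E, ∑ e, τ e * K e * ‖D e u‖ ^ 2 ≤ ρ * ‖u‖ ^ 2) :
    ∃ C γ : ℝ, 0 < C ∧ 0 < γ ∧ ∀ (x : ℝ → E) (_ : Continuous x)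
      (_ : ∀ t, 0 < t → HasDerivAt x (delayedVelocity D K τ x t) t)
      (_ : ∀ t, 0 < t → lam * ‖x t‖ ^ 2 ≤ ∑ e, K e * ‖D e (x t)‖ ^ 2) (R : ℝ),
      (∀ s ∈ Set.Icc (-r) 0, ‖x s‖ ≤ R) →
      ∀ t, 0 ≤ t → ‖x t‖ ≤ C * R * Real.exp (-γ * t) := by
  obtain ⟨C₀, γ, hC₀, hγ, hmain⟩ := exists_lyapunov hK hτ hr hτr hρ hlam hform
  set M := ∑ e, K e * ‖D e‖ ^ 2 + 1 with hMdef
  have hDM0 : 0 ≤ ∑ e, K e * ‖D e‖ ^ 2 :=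
    Finset.sum_nonneg fun e _ => mul_nonneg (hK e) (sq_nonneg _)
  have hM : 0 < M := by linarith
  set β := 2 * Real.exp (2 * M * (r + 1)) with hβ
  have hβ0 : 0 < β := by positivity
  refine ⟨(1 + Real.sqrt C₀ * M) * β * Real.exp (γ / 2 * (r + 1)), γ / 2, by positivity,
    by positivity, ?_⟩
  intro x hx hd hco R hR t ht
  have hR0 : 0 ≤ R := (norm_nonneg _).trans (hR 0 ⟨by linarith, le_rfl⟩)
  have hB : ∀ s ∈ Set.Icc (-r) (r + 1), ‖x s‖ ≤ β * R := by
    intro s hs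
    refine (norm_le_of_delayed hK hτ hr hτr hx hd hM (by linarith) hR
      (by linarith : 0 ≤ r + 1) s hs).trans (le_of_eq ?_)
    rw [hβ]; ring
  have hexp : (1 + Real.sqrt C₀ * M) * β * Real.exp (γ / 2 * (r + 1)) * R *
      Real.exp (-(γ / 2) * t)
      = (1 + Real.sqrt C₀ * M) * β * R * Real.exp (-(γ / 2) * (t - (r + 1))) := by
    rw [show -(γ / 2) * (t - (r + 1)) = γ / 2 * (r + 1) + -(γ / 2) * t by ring, Real.exp_add]
    ring
  rw [hexp]
  rcases le_total t (r + 1) with htr | htr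
  · have h1 : 1 ≤ Real.exp (-(γ / 2) * (t - (r + 1))) := Real.one_le_exp (by nlinarith)
    have h2 : β * R ≤ (1 + Real.sqrt C₀ * M) * β * R := by
      have : 0 ≤ Real.sqrt C₀ * M * (β * R) := by positivity
      linarith
    calc ‖x t‖ ≤ β * R := hB t ⟨by linarith, htr⟩
      _ ≤ (1 + Real.sqrt C₀ * M) * β * R * 1 := by linarith
      _ ≤ _ := by gcongr
  · have hA : ∀ s ∈ Set.Icc 1 (r + 1), ‖delayedVelocity D K τ x s‖ ^ 2 ≤ (M * (β * R)) ^ 2 := by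
      intro s hs
      refine pow_le_pow_left₀ (norm_nonneg _) ?_ 2
      refine (norm_delayedVelocity_le (B := β * R) hK fun e =>
        hB _ ⟨by linarith [hs.1, hτr e], by linarith [hs.2, hτ e]⟩).trans ?_
      exact mul_le_mul_of_nonneg_right (by linarith) (by positivity)
    have h := hmain x hx hd hco _ hA t htr
    have hsq : C₀ * (M * (β * R)) ^ 2 * Real.exp (-γ * (t - (r + 1)))
        = (Real.sqrt C₀ * M * β * R * Real.exp (-(γ / 2) * (t - (r + 1)))) ^ 2 := by
      rw [mul_pow _ (Real.exp _), ← Real.exp_nat_mul]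
      simp only [mul_pow, Real.sq_sqrt hC₀.le]
      rw [show ((2 : ℕ) : ℝ) * (-(γ / 2) * (t - (r + 1))) = -γ * (t - (r + 1)) by push_cast; ring]
      ring
    rw [hsq] at h
    have h' := le_of_sq_le_sq h (by positivity)
    refine h'.trans (mul_le_mul_of_nonneg_right ?_ (Real.exp_pos _).le)
    have : 0 ≤ β * R := by positivity
    linarith

end Delay

/-! ### Edge differences and the deviation from consensus -/

section Graph

variable {V : Type*} {G : SimpleGraph V} {d : ℕ}

lemma mk_out (e : Sym2 V) : s((Quot.out e).1, (Quot.out e).2) = e := Quot.out_eq e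

lemma adj_out (e : G.edgeSet) : G.Adj (Quot.out (e : Sym2 V)).1 (Quot.out (e : Sym2 V)).2 := by
  rw [← SimpleGraph.mem_edgeSet, mk_out]
  exact e.2

lemma maxDelay_nonneg {τ : G.edgeSet → ℝ} (hτ : ∀ e, 0 ≤ τ e) : 0 ≤ maxDelay τ :=
  Real.iSup_nonneg hτ

variable [Fintype V]

lemma le_maxDelay (τ : G.edgeSet → ℝ) (e : G.edgeSet) : τ e ≤ maxDelay τ :=
  le_ciSup (Set.finite_range τ).bddAbove e

/-- The coordinate map `x ↦ x(i)` of a node as a continuous linear map. -/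
noncomputable def nodeCLM (d : ℕ) (i : V) : State V d →L[ℝ] EuclideanSpace ℝ (Fin d) :=
  LinearMap.toContinuousLinearMap
    { toFun := fun x => State.node x i
      map_add' := fun _ _ => rfl
      map_smul' := fun _ _ => rfl }

lemma nodeCLM_apply (i : V) (x : State V d) (k : Fin d) : nodeCLM d i x k = x (i, k) := rfl

/-- The difference `x(i) - x(j)` across an edge. The orientation `(i, j)` of the edge is arbitrary:
it is the one that `Quot.out` selects. -/
noncomputable def edgeDiff (d : ℕ) (e : G.edgeSet) : State V d →L[ℝ] EuclideanSpace ℝ (Fin d) :=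
  nodeCLM d (Quot.out (e : Sym2 V)).1 - nodeCLM d (Quot.out (e : Sym2 V)).2

lemma edgeDiff_apply (e : G.edgeSet) (x : State V d) (k : Fin d) :
    edgeDiff d e x k = x ((Quot.out (e : Sym2 V)).1, k) - x ((Quot.out (e : Sym2 V)).2, k) := rfl

lemma pairEnergy_eq (e : G.edgeSet) (x : State V d) :
    pairEnergy (e : Sym2 V) x = ‖edgeDiff d e x‖ ^ 2 / 2 := by
  conv_lhs => rw [← mk_out (e : Sym2 V)]
  rfl

lemma gradient_pairEnergy (e : G.edgeSet) (x : State V d) :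
    gradient (pairEnergy (e : Sym2 V)) x = (edgeDiff d e).adjoint (edgeDiff d e x) := by
  apply HasGradientAt.gradient
  rw [hasGradientAt_iff_hasFDerivAt]
  have h := ((edgeDiff d e).hasFDerivAt (x := x)).norm_sq.mul_const (2⁻¹ : ℝ)
  have hfun : (pairEnergy (e : Sym2 V) : State V d → ℝ)
      = fun y => ‖edgeDiff d e y‖ ^ 2 * 2⁻¹ := by
    funext y
    rw [pairEnergy_eq, div_eq_mul_inv]
  rw [hfun]
  refine h.congr_fderiv ?_
  ext u
  simp [ContinuousLinearMap.adjoint_inner_left]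

lemma nodeCLM_consensus (i : V) (x : State V d) :
    nodeCLM d i (consensus x) = (Fintype.card V : ℝ)⁻¹ • ∑ j, nodeCLM d j x := by
  ext k
  simp [nodeCLM_apply, consensus, WithLp.ofLp_sum, Finset.sum_apply]

lemma edgeDiff_consensus (e : G.edgeSet) (x : State V d) : edgeDiff d e (consensus x) = 0 := by
  simp only [edgeDiff, sub_apply, nodeCLM_consensus, sub_self]

/-- The gradient of an edge energy has zero total: it is orthogonal to all consensus states. -/
lemma sum_nodeCLM_adjoint_edgeDiff (e : G.edgeSet) (u : EuclideanSpace ℝ (Fin d)) :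
    ∑ i : V, nodeCLM d i ((edgeDiff d e).adjoint u) = 0 := by
  have hconst : ∀ a : EuclideanSpace ℝ (Fin d),
      edgeDiff d e (WithLp.toLp 2 fun p : V × Fin d => a p.2) = 0 := by
    intro a
    ext k
    simp [edgeDiff_apply]
  refine ext_inner_left ℝ fun a => ?_
  have h := ContinuousLinearMap.adjoint_inner_right (edgeDiff d e)
    (WithLp.toLp 2 fun p : V × Fin d => a p.2) u
  rw [hconst, inner_zero_left] at h
  rw [inner_zero_right, ← h, inner_sum]
  simp only [PiLp.inner_apply, Fintype.sum_prod_type, nodeCLM_apply]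

lemma eq_of_edgeDiff_eq_zero (hG : G.Connected) {x : State V d}
    (hx : ∀ e : G.edgeSet, edgeDiff d e x = 0) (i j : V) : nodeCLM d i x = nodeCLM d j x := by
  have hadj : ∀ a b, G.Adj a b → nodeCLM d a x = nodeCLM d b x := by
    intro a b hab
    have h := sub_eq_zero.1 (hx ⟨s(a, b), G.mem_edgeSet.mpr hab⟩)
    change nodeCLM d (Quot.out s(a, b)).1 x = nodeCLM d (Quot.out s(a, b)).2 x at h
    rcases Sym2.eq_iff.1 (mk_out s(a, b)) with ⟨h1, h2⟩ | ⟨h1, h2⟩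
    · rwa [h1, h2] at h
    · rw [h1, h2] at h; exact h.symm
  obtain ⟨p⟩ := hG.preconnected i j
  induction p with
  | nil => rfl
  | cons h _ ih => exact (hadj _ _ h).trans ih

lemma sum_nodeCLM_sub_consensus [Nonempty V] (u : State V d) :
    ∑ i, nodeCLM d i (u - consensus u) = 0 := by
  simp only [map_sub, nodeCLM_consensus, Finset.sum_sub_distrib, Finset.sum_const,
    Finset.card_univ]
  rw [← Nat.cast_smul_eq_nsmul ℝ, smul_smul, mul_inv_cancel₀ (by simp), one_smul, sub_self]

/-- The deviation of `y` from the consensus state of `y 0`. Its history before `-maxDelay τ` is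
frozen, which makes it continuous on the whole line. -/
noncomputable def deviation (τ : G.edgeSet → ℝ) (y : ℝ → State V d) (t : ℝ) : State V d :=
  y (max t (-maxDelay τ)) - consensus (y 0)

lemma deviation_of_le {τ : G.edgeSet → ℝ} (y : ℝ → State V d) {t : ℝ} (ht : -maxDelay τ ≤ t) :
    deviation τ y t = y t - consensus (y 0) := by
  rw [deviation, max_eq_left ht]

variable [DecidableRel G.Adj]

/-- Coercivity of the energy of a connected graph on states of zero average. -/
lemma exists_coercive (hG : G.Connected) (d : ℕ) {K : G.edgeSet → ℝ} (hK : ∀ e, 0 < K e) :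
    ∃ lam : ℝ, 0 < lam ∧ ∀ x : State V d, ∑ i, nodeCLM d i x = 0 →
      lam * ‖x‖ ^ 2 ≤ ∑ e, K e * ‖edgeDiff d e x‖ ^ 2 := by
  have hV : Nonempty V := hG.nonempty
  let T : State V d →ₗ[ℝ] (G.edgeSet → EuclideanSpace ℝ (Fin d)) × EuclideanSpace ℝ (Fin d) :=
    (LinearMap.pi fun e => (edgeDiff d e : State V d →ₗ[ℝ] EuclideanSpace ℝ (Fin d))).prod
      (∑ i, nodeCLM d i : State V d →L[ℝ] EuclideanSpace ℝ (Fin d))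
  have hT : ∀ x, T x = (fun e => edgeDiff d e x, ∑ i, nodeCLM d i x) := by
    intro x
    simp [T, LinearMap.pi]
  have hker : LinearMap.ker T = ⊥ := by
    rw [LinearMap.ker_eq_bot']
    intro x hx
    rw [hT, Prod.mk_eq_zero] at hx
    have heq := eq_of_edgeDiff_eq_zero hG fun e => congrFun hx.1 e
    ext ⟨i, k⟩
    have h2 := hx.2
    rw [Finset.sum_congr rfl fun j _ => heq j i, Finset.sum_const, Finset.card_univ,
      ← Nat.cast_smul_eq_nsmul ℝ, smul_eq_zero] at h2
    have h3 := h2.resolve_left (Nat.cast_ne_zero.2 Fintype.card_ne_zero)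
    rw [← nodeCLM_apply, h3]
    rfl
  obtain ⟨c, hc, hanti⟩ := T.exists_antilipschitzWith hker
  have hc' : (0 : ℝ) < c := hc
  -- Reciprocals of the weights are bounded, here by their sum.
  set κ : ℝ := ∑ e, (K e)⁻¹ + 1 with hκ
  have hκ0 : 0 < κ := by
    have : 0 ≤ ∑ e, (K e)⁻¹ := Finset.sum_nonneg fun e _ => (inv_pos.2 (hK e)).le
    linarith
  refine ⟨((c : ℝ) ^ 2 * κ)⁻¹, by positivity, fun x hx => ?_⟩
  set q := ∑ e, K e * ‖edgeDiff d e x‖ ^ 2 with hq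
  have hterm : ∀ e, 0 ≤ K e * ‖edgeDiff d e x‖ ^ 2 := fun e =>
    mul_nonneg (hK e).le (sq_nonneg _)
  have hq0 : 0 ≤ q := Finset.sum_nonneg fun e _ => hterm e
  have hnorm : ‖T x‖ ≤ Real.sqrt (κ * q) := by
    rw [hT, hx, Prod.norm_def, norm_zero]
    refine max_le ((pi_norm_le_iff_of_nonneg (Real.sqrt_nonneg _)).2 fun e => ?_)
      (Real.sqrt_nonneg _)
    refine Real.le_sqrt_of_sq_le ?_
    have h1 : K e * ‖edgeDiff d e x‖ ^ 2 ≤ q :=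
      Finset.single_le_sum (fun e _ => hterm e) (Finset.mem_univ e)
    have h2 : (K e)⁻¹ ≤ κ := by
      have := Finset.single_le_sum (f := fun e => (K e)⁻¹)
        (fun e _ => (inv_pos.2 (hK e)).le) (Finset.mem_univ e)
      linarith
    calc ‖edgeDiff d e x‖ ^ 2 = (K e)⁻¹ * (K e * ‖edgeDiff d e x‖ ^ 2) := by
          rw [inv_mul_cancel_left₀ (hK e).ne']
      _ ≤ κ * q := mul_le_mul h2 h1 (hterm e) hκ0.le
  have hle : ‖x‖ ≤ c * Real.sqrt (κ * q) := by
    have h := hanti.le_mul_dist x 0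
    rw [map_zero, dist_zero_right, dist_zero_right] at h
    exact h.trans (mul_le_mul_of_nonneg_left hnorm c.2)
  have hsq := pow_le_pow_left₀ (norm_nonneg _) hle 2
  rw [mul_pow, Real.sq_sqrt (mul_nonneg hκ0.le hq0)] at hsq
  rw [inv_mul_le_iff₀ (by positivity)]
  linarith

/-- The total of the nodes is conserved. -/
lemma sum_nodeCLM_eq_zero {K τ : G.edgeSet → ℝ} {x : ℝ → State V d} (hx : Continuous x)
    (hd : ∀ t, 0 < t → HasDerivAt x (delayedVelocity (edgeDiff d) K τ x t) t)
    (h0 : ∑ i, nodeCLM d i (x 0) = 0) {t : ℝ} (ht : 0 < t) : ∑ i, nodeCLM d i (x t) = 0 := by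
  have hder : ∀ s, 0 < s → HasDerivAt (fun s => ∑ i, nodeCLM d i (x s)) 0 s := by
    intro s hs
    refine (HasDerivAt.fun_sum fun i _ =>
      (nodeCLM d i).hasFDerivAt.comp_hasDerivAt s (hd s hs)).congr_deriv ?_
    simp only [delayedVelocity, map_neg, map_sum, map_smul, Finset.sum_neg_distrib]
    rw [Finset.sum_comm, neg_eq_zero]
    refine Finset.sum_eq_zero fun e _ => ?_
    rw [← Finset.smul_sum, sum_nodeCLM_adjoint_edgeDiff, smul_zero]
  have hc : Continuous fun s => ∑ i, nodeCLM d i (x s) := by fun_prop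
  -- The equation need not hold at time `0`, which is reached by continuity.
  have hconst : ∀ a ∈ Set.Ioo 0 t, ∑ i, nodeCLM d i (x t) = ∑ i, nodeCLM d i (x a) := fun a ha =>
    constant_of_has_deriv_right_zero hc.continuousOn
      (fun b hb => (hder b (ha.1.trans_le hb.1)).hasDerivWithinAt) t ⟨ha.2.le, le_rfl⟩
  have hlim : Filter.Tendsto (fun a => ∑ i, nodeCLM d i (x a)) (nhdsWithin 0 (Set.Ioi 0))
      (nhds (∑ i, nodeCLM d i (x 0))) :=
    (hc.tendsto 0).mono_left nhdsWithin_le_nhds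
  rw [← h0]
  refine tendsto_nhds_unique (tendsto_const_nhds.congr' ?_) hlim
  filter_upwards [Ioo_mem_nhdsGT ht] with a ha using hconst a ha

variable [DecidableEq V]

/-! ### The quadratic form of the weighted Laplacian -/

/-- A sum over ordered pairs of nodes of a symmetric weight counts every edge twice. -/
lemma sum_adj_eq_two_mul_sum_edgeSet (g : Sym2 V → ℝ) :
    ∑ i, ∑ j, (if G.Adj i j then g s(i, j) else 0) = 2 * ∑ e : G.edgeSet, g e := by
  have h1 : ∀ i j, (if G.Adj i j then g s(i, j) else 0)
      = ∑ e : G.edgeSet, if s(i, j) = (e : Sym2 V) then g e else 0 := by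
    intro i j
    split_ifs with h
    · rw [Finset.sum_eq_single ⟨s(i, j), G.mem_edgeSet.mpr h⟩]
      · simp
      · intro e _ he
        rw [if_neg]
        rintro h'
        exact he (Subtype.ext h'.symm)
      · simp
    · refine (Finset.sum_eq_zero fun e _ => if_neg ?_).symm
      rintro h'
      exact h (by rw [← SimpleGraph.mem_edgeSet, h']; exact e.2)
  simp_rw [h1]
  rw [Finset.mul_sum]
  rw [Finset.sum_congr rfl fun i _ => Finset.sum_comm, Finset.sum_comm]
  refine Finset.sum_congr rfl fun e _ => ?_
  have hne := (adj_out e).ne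
  have h2 : ∀ i j, (if s(i, j) = (e : Sym2 V) then g e else 0)
      = (if i = (Quot.out (e : Sym2 V)).1 then
          if j = (Quot.out (e : Sym2 V)).2 then g e else 0 else 0)
      + (if i = (Quot.out (e : Sym2 V)).2 then
          if j = (Quot.out (e : Sym2 V)).1 then g e else 0 else 0) := by
    intro i j
    have : s(i, j) = (e : Sym2 V) ↔ (i = (Quot.out (e : Sym2 V)).1 ∧ j = (Quot.out (e : Sym2 V)).2)
        ∨ (i = (Quot.out (e : Sym2 V)).2 ∧ j = (Quot.out (e : Sym2 V)).1) := by
      conv_lhs => rw [← mk_out (e : Sym2 V)]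
      exact Sym2.eq_iff
    simp only [this]
    grind
  simp_rw [h2, Finset.sum_add_distrib]
  simp
  ring

lemma isHermitian_weightedLaplacian (ν : G.edgeSet → ℝ) :
    (weightedLaplacian G ν).IsHermitian := by
  ext i j
  simp only [weightedLaplacian, Matrix.conjTranspose_apply, Matrix.of_apply, star_trivial]
  by_cases h : G.Adj i j
  · rw [dif_pos h, dif_pos h.symm]
    simp only [Sym2.eq_swap]
  · rw [dif_neg h, dif_neg fun h' => h h'.symm]
    by_cases hij : i = j
    · subst hij; rfl
    · rw [if_neg hij, if_neg (Ne.symm hij)]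

/-- The quadratic form of the weighted Laplacian is the weighted sum of squared edge differences. -/
lemma dotProduct_weightedLaplacian_mulVec (ν : G.edgeSet → ℝ) (x : V → ℝ) :
    x ⬝ᵥ (weightedLaplacian G ν).mulVec x
      = ∑ e : G.edgeSet, ν e *
        (x (Quot.out (e : Sym2 V)).1 - x (Quot.out (e : Sym2 V)).2) ^ 2 := by
  set w : V → V → ℝ := fun i j =>
    if h : G.Adj i j then ν ⟨s(i, j), G.mem_edgeSet.mpr h⟩ else 0 with hw
  have hsymm : ∀ i j, w i j = w j i := by
    intro i j
    simp only [hw]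
    by_cases h : G.Adj i j
    · rw [dif_pos h, dif_pos h.symm]
      simp only [Sym2.eq_swap]
    · rw [dif_neg h, dif_neg fun h' => h h'.symm]
  have hentry : ∀ i j, weightedLaplacian G ν i j = (if i = j then ∑ k, w i k else 0) - w i j := by
    intro i j
    simp only [weightedLaplacian, Matrix.of_apply, hw]
    by_cases h : G.Adj i j
    · rw [dif_pos h, dif_pos h, if_neg h.ne, zero_sub]
    · rw [dif_neg h, dif_neg h, sub_zero]
  have hquad : x ⬝ᵥ (weightedLaplacian G ν).mulVec x
      = ∑ i, ∑ j, w i j * x i ^ 2 - ∑ i, ∑ j, w i j * (x i * x j) := by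
    simp only [dotProduct, Matrix.mulVec, hentry, sub_mul, Finset.sum_sub_distrib, mul_sub,
      ite_mul, zero_mul, Finset.sum_ite_eq, Finset.mem_univ, if_true, Finset.mul_sum,
      Finset.sum_mul]
    congr 1 <;> exact Finset.sum_congr rfl fun i _ => Finset.sum_congr rfl fun j _ => by ring
  have hswap : ∑ i, ∑ j, w i j * x i ^ 2 = ∑ i, ∑ j, w i j * x j ^ 2 := by
    rw [Finset.sum_comm]
    exact Finset.sum_congr rfl fun i _ => Finset.sum_congr rfl fun j _ => by rw [hsymm]
  have htwo : 2 * (x ⬝ᵥ (weightedLaplacian G ν).mulVec x)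
      = ∑ i, ∑ j, w i j * (x i - x j) ^ 2 := by
    rw [hquad, mul_sub, two_mul]
    nth_rewrite 2 [hswap]
    simp only [Finset.mul_sum, ← Finset.sum_add_distrib, ← Finset.sum_sub_distrib]
    exact Finset.sum_congr rfl fun i _ => Finset.sum_congr rfl fun j _ => by ring
  -- The weight as a function on all of `Sym2 V`; the value off the edges is immaterial.
  have hsum := sum_adj_eq_two_mul_sum_edgeSet (G := G) fun e =>
    (if h : e ∈ G.edgeSet then ν ⟨e, h⟩ else 0) * (x (Quot.out e).1 - x (Quot.out e).2) ^ 2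
  have hterm : ∀ i j, (if G.Adj i j then (if h : s(i, j) ∈ G.edgeSet then ν ⟨s(i, j), h⟩ else 0)
      * (x (Quot.out s(i, j)).1 - x (Quot.out s(i, j)).2) ^ 2 else 0)
      = w i j * (x i - x j) ^ 2 := by
    intro i j
    by_cases h : G.Adj i j
    · rw [if_pos h, dif_pos (G.mem_edgeSet.mpr h)]
      simp only [hw]
      rw [dif_pos h]
      rcases Sym2.eq_iff.1 (mk_out s(i, j)) with ⟨h1, h2⟩ | ⟨h1, h2⟩
      · rw [h1, h2]
      · rw [h1, h2]; ring
    · simp only [hw]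
      rw [if_neg h, dif_neg h, zero_mul]
  simp_rw [hterm] at hsum
  rw [← htwo] at hsum
  refine (mul_left_cancel₀ two_ne_zero hsum).trans (Finset.sum_congr rfl fun e _ => ?_)
  rw [dif_pos e.2]

/-- A symmetric matrix of spectral radius below `1` has a quadratic form bounded by a multiple
`ρ < 1` of the squared norm. -/
lemma exists_dotProduct_mulVec_le {A : Matrix V V ℝ} (hA : A.IsHermitian)
    (h : spectralRadius ℝ A < 1) :
    ∃ ρ : ℝ, ρ < 1 ∧ ∀ x : V → ℝ, x ⬝ᵥ A.mulVec x ≤ ρ * (x ⬝ᵥ x) := by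
  obtain ⟨c, hc, hc1⟩ := ENNReal.lt_iff_exists_nnreal_btwn.1 h
  refine ⟨c, by exact_mod_cast hc1, fun x => ?_⟩
  have hle : ∀ μ ∈ spectrum ℝ A, μ ≤ c := by
    intro μ hμ
    have h1 : (‖μ‖₊ : ENNReal) ≤ spectralRadius ℝ A := le_iSup₂_of_le μ hμ le_rfl
    have h2 : ‖μ‖₊ ≤ c := by exact_mod_cast h1.trans hc.le
    exact (le_abs_self μ).trans (by exact_mod_cast h2)
  have hherm : (algebraMap ℝ (Matrix V V ℝ) c - A).IsHermitian := by
    refine Matrix.IsHermitian.sub ?_ hA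
    rw [Matrix.algebraMap_eq_diagonal]
    exact Matrix.isHermitian_diagonal _
  have hpsd : (algebraMap ℝ (Matrix V V ℝ) c - A).PosSemidef := by
    rw [hherm.posSemidef_iff_eigenvalues_nonneg]
    intro i
    have hi := hherm.eigenvalues_mem_spectrum_real i
    rw [← spectrum.singleton_sub_eq, Set.singleton_sub] at hi
    obtain ⟨μ, hμ, hμi⟩ := hi
    change 0 ≤ hherm.eigenvalues i
    rw [← hμi]
    exact sub_nonneg.2 (hle μ hμ)
  have hx := hpsd.dotProduct_mulVec_nonneg x
  rw [Matrix.sub_mulVec, dotProduct_sub, Algebra.algebraMap_eq_smul_one, Matrix.smul_mulVec,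
    Matrix.one_mulVec, dotProduct_smul, star_trivial, smul_eq_mul] at hx
  linarith

lemma exists_sum_edgeDiff_le (d : ℕ) {ν : G.edgeSet → ℝ}
    (h : spectralRadius ℝ (weightedLaplacian G ν) < 1) :
    ∃ ρ : ℝ, ρ < 1 ∧ ∀ x : State V d, ∑ e, ν e * ‖edgeDiff d e x‖ ^ 2 ≤ ρ * ‖x‖ ^ 2 := by
  obtain ⟨ρ, hρ, hle⟩ := exists_dotProduct_mulVec_le (isHermitian_weightedLaplacian ν) h
  refine ⟨ρ, hρ, fun x => ?_⟩
  have hk := Finset.sum_le_sum fun (k : Fin d) (_ : k ∈ Finset.univ) => hle fun i => x (i, k)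
  simp only [dotProduct_weightedLaplacian_mulVec] at hk
  rw [Finset.sum_comm, ← Finset.mul_sum] at hk
  simp only [EuclideanSpace.real_norm_sq_eq, edgeDiff_apply, Finset.mul_sum]
  simp only [dotProduct, ← pow_two, Finset.mul_sum] at hk
  rw [Fintype.sum_prod_type, Finset.sum_comm (s := (Finset.univ : Finset V))]
  exact hk

/-! ### Solutions of the delayed equation -/

lemma IsSolution.continuous_deviation {K τ : G.edgeSet → ℝ} {y : ℝ → State V d}
    (hy : IsSolution K τ y) : Continuous (deviation τ y) :=
  (hy.continuousOn.comp_continuous (continuous_id.max continuous_const)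
    fun s => Set.mem_Ici.2 (le_max_right s _)).sub continuous_const

lemma IsSolution.hasDerivAt_deviation {K τ : G.edgeSet → ℝ} {y : ℝ → State V d}
    (hτ : ∀ e, 0 ≤ τ e) (hy : IsSolution K τ y) {t : ℝ} (ht : 0 < t) :
    HasDerivAt (deviation τ y) (delayedVelocity (edgeDiff d) K τ (deviation τ y) t) t := by
  have h := (hy.hasDerivAt t ht).sub_const (consensus (y 0))
  have hev : deviation τ y =ᶠ[nhds t] fun s => y s - consensus (y 0) := by
    filter_upwards [lt_mem_nhds ht] with a ha
    exact deviation_of_le y (by linarith [maxDelay_nonneg hτ])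
  refine (h.congr_of_eventuallyEq hev).congr_deriv ?_
  rw [delayedVelocity]
  refine congrArg Neg.neg (Finset.sum_congr rfl fun e _ => ?_)
  rw [gradient_pairEnergy, deviation_of_le y (by linarith [le_maxDelay τ e]), map_sub,
    edgeDiff_consensus, sub_zero]

end Graph

end DelayedGossip

open DelayedGossip in
theorem proposition1 {V : Type*} [Fintype V] [DecidableEq V] (G : SimpleGraph V)
    [DecidableRel G.Adj] (hG : G.Connected) (d : ℕ) (K τ : G.edgeSet → ℝ)
    (hK : ∀ e, 0 < K e) (hτ : ∀ e, 0 ≤ τ e)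
    (hρ : spectralRadius ℝ (DelayedGossip.weightedLaplacian G fun e => τ e * K e) < 1) :
    DelayedGossip.IsStable d K τ := by
  have hV : Nonempty V := hG.nonempty
  obtain ⟨ρ, hρ1, hform⟩ := exists_sum_edgeDiff_le d hρ
  obtain ⟨lam, hlam, hco⟩ := exists_coercive hG d hK
  have hr := maxDelay_nonneg hτ
  obtain ⟨C, γ, hC, hγ, hmain⟩ := exists_exponential_bound (E := State V d)
    (F := EuclideanSpace ℝ (Fin d)) (D := edgeDiff d) (K := K) (τ := τ) (fun e => (hK e).le) hτ hr
    (le_maxDelay τ) hρ1 hlam hform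
  refine ⟨C, γ, hC, hγ, fun y hy R hR t ht => ?_⟩
  have hd : ∀ s, 0 < s → HasDerivAt (deviation τ y)
      (delayedVelocity (edgeDiff d) K τ (deviation τ y) s) s :=
    fun s hs => hy.hasDerivAt_deviation hτ hs
  have h0 : ∑ i, nodeCLM d i (deviation τ y 0) = 0 := by
    rw [deviation_of_le y (by linarith)]
    exact sum_nodeCLM_sub_consensus (y 0)
  have h := hmain (deviation τ y) hy.continuous_deviation hd
    (fun s hs => hco _ (sum_nodeCLM_eq_zero hy.continuous_deviation hd h0 hs)) R
    (fun s hs => by rw [deviation_of_le y hs.1]; exact hR s hs) t ht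
  rwa [deviation_of_le y (by linarith)] at h
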